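/- Let $n$ be an integer with $n>1$ and let $\kappa$ be an infinite cardinal. Then there is an $n$-resolvable Tychonoff space $(X,\mathcal T)$ with $|X|=\kappa$ which admits no exactly $n$-resolvable quasi-regular expansion. Moreover, $(X,\mathcal T)$ can be chosen to be a subspace of the Cantor cube $\{0,1\}^{2^\kappa}$ (with the product topology) of the form $X=\bigcup_{i<n+1}D_i$, where the sets $D_i$ are pairwise disjoint, each $D_i$ is dense in $\{0,1\}^{2^\kappa}$, and each $D_i$ is submaximal in the subspace topology. Here a space is *$n$-resolvable* if it has $n$ pairwise disjoint nonempty dense subsets, and *exactly $n$-resolvable* if it is $n$-resolvable but not $(n+1)$-resolvable. It is *quasi-regular* if every nonempty open set $U$ contains the closure of some nonempty open set $V$, and *submaximal* if each of its dense subsets is open. An *expansion* of $(X,\mathcal T)$ is a space $(X,\mathcal U)$ with $\mathcal U\supseteq\mathcal T$. -/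

import Mathlib

open scoped Topology

universe u

namespace Resolvability

/-- `(X, T)` is `n`-resolvable: there are `n` pairwise disjoint nonempty subsets of `X`,
each dense in `(X, T)`. -/
def IsResolvable {X : Type*} (n : ℕ) (T : TopologicalSpace X) : Prop :=
  ∃ D : Fin n → Set X,
    (∀ i j, i ≠ j → Disjoint (D i) (D j)) ∧ ∀ i, (D i).Nonempty ∧ @Dense X T (D i)

/-- `(X, T)` is exactly `n`-resolvable: it is `n`-resolvable but not `(n + 1)`-resolvable. -/
def IsExactlyResolvable {X : Type*} (n : ℕ) (T : TopologicalSpace X) : Prop :=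
  IsResolvable n T ∧ ¬ IsResolvable (n + 1) T

/-- `(X, T)` is quasi-regular: every nonempty open set contains the closure of a nonempty
open set. -/
def IsQuasiRegular {X : Type*} (T : TopologicalSpace X) : Prop :=
  ∀ U : Set X, IsOpen[T] U → U.Nonempty →
    ∃ V : Set X, IsOpen[T] V ∧ V.Nonempty ∧ closure[T] V ⊆ U

/-- `(X, T)` is submaximal: every dense subset is open. -/
def IsSubmaximal {X : Type*} (T : TopologicalSpace X) : Prop :=
  ∀ S : Set X, @Dense X T S → IsOpen[T] S

/-- `U` is an expansion of `T`: every `T`-open set is `U`-open, that is, `U ⊇ T`. -/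
def IsExpansion {X : Type*} (U T : TopologicalSpace X) : Prop :=
  ∀ S : Set X, IsOpen[T] S → IsOpen[U] S

/-- The Cantor cube `{0,1}^(2^κ)`, with the product topology. -/
abbrev CantorCube (κ : Cardinal.{u}) : Type u := Quotient.out (2 ^ κ : Cardinal.{u}) → Bool

end Resolvability

/-
Submaximality is inherited along continuous injections, so the pieces `D i` stay submaximal in an
expansion. A nonempty open set covered by `k` submaximal pieces cannot carry more than `k` disjoint
dense sets. If some `D j` missed a nonempty open set of an `n`-resolvable quasi-regular expansion,
take there an open `V` in which each piece is dense or absent, and an open `W` whose closure lies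
in `V`. At least `n` pieces are dense in `V`; each of them is contained in `W` near some point of
`W`, for the original topology. Outside `closure W`, an original open set therefore contains a
nonempty open set covered by the remaining pieces, so there are at least `n` of these as well,
which is too many. Hence all the pieces are dense in the expansion.

For the construction, start from a dense family `φ : Y → Ξ → Bool` of points of the cube and a
maximal filter `F` all of whose members index dense sets. Modifying each coordinate off a member of
`F` makes every member of `F` relatively open, and turns the family into a dense submaximal
subspace. Coordinatewise homeomorphisms of the cube then produce disjoint copies.
-/

namespace Resolvability

open Set Filter Function
open scoped Cardinal

section Submaximal

variable {X Y : Type*} [TX : TopologicalSpace X] [TY : TopologicalSpace Y]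

/-- Submaximality of a subset, with respect to the subspace topology. -/
abbrev IsSubmaximalSet (S : Set X) : Prop :=
  IsSubmaximal (instTopologicalSpaceSubtype : TopologicalSpace S)

theorem IsSubmaximal.of_continuous_injective {f : Y → X} (hX : IsSubmaximal TX)
    (hf : Continuous f) (hinj : Injective f) : IsSubmaximal TY := by
  intro A hA
  have hdense : Dense (f '' A ∪ (range f)ᶜ) := fun x => by
    by_cases hx : x ∈ range f
    · exact closure_mono subset_union_left (hf.range_subset_closure_image_dense hA hx)
    · exact subset_closure (Or.inr hx)
  have hpre : f ⁻¹' (f '' A ∪ (range f)ᶜ) = A := by simp [hinj.preimage_image]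
  exact hpre ▸ (hX _ hdense).preimage hf

theorem IsSubmaximalSet.preimage {S : Set X} (hS : IsSubmaximalSet S) {f : Y → X}
    (hf : Continuous f) (hinj : Injective f) : IsSubmaximalSet (f ⁻¹' S) :=
  hS.of_continuous_injective hf.restrictPreimage (hinj.restrictPreimage S)

theorem IsSubmaximalSet.mono {S S' : Set X} (hS : IsSubmaximalSet S) (h : S' ⊆ S) :
    IsSubmaximalSet S' :=
  hS.of_continuous_injective (continuous_inclusion h) (inclusion_injective h)

theorem IsSubmaximal.inter_nonempty_of_dense [Nonempty X] (hX : IsSubmaximal TX) {A B : Set X}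
    (hA : Dense A) (hB : Dense B) : (A ∩ B).Nonempty :=
  (hA.inter_of_isOpen_left hB (hX A hA)).nonempty

theorem IsSubmaximalSet.inter_nonempty_of_subset_closure {S A B V : Set X}
    (hS : IsSubmaximalSet S) (hV : IsOpen V) (hne : V.Nonempty) (hA : V ⊆ closure (A ∩ S))
    (hB : V ⊆ closure (B ∩ S)) : (A ∩ B).Nonempty := by
  have hdense {C : Set X} (hC : V ⊆ closure (C ∩ S)) :
      Dense (Subtype.val ⁻¹' C : Set ↥(V ∩ S)) := by
    rw [Subtype.dense_iff, Subtype.image_preimage_coe, inter_right_comm, inter_assoc]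
    exact inter_subset_left.trans ((subset_inter subset_rfl hC).trans hV.inter_closure)
  have : Nonempty ↥(V ∩ S) := by
    obtain ⟨x, hx⟩ := hne
    obtain ⟨y, hyV, -, hyS⟩ := mem_closure_iff.1 (hA hx) V hV hx
    exact ⟨y, hyV, hyS⟩
  obtain ⟨x, hxA, hxB⟩ := (hS.mono inter_subset_right : IsSubmaximalSet (V ∩ S))
    |>.inter_nonempty_of_dense (hdense hA) (hdense hB)
  exact ⟨x, hxA, hxB⟩

theorem IsSubmaximal.exists_isOpen_inter_eq_singleton (hX : IsSubmaximal TX) {A : Set X}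
    (hA : interior A = ∅) {a : X} (ha : a ∈ A) : ∃ N, IsOpen N ∧ N ∩ A = {a} := by
  have hdense : Dense (insert a Aᶜ) :=
    (interior_eq_empty_iff_dense_compl.1 hA).mono (subset_insert _ _)
  refine ⟨insert a Aᶜ, hX _ hdense, ?_⟩
  rw [insert_inter_of_mem ha, compl_inter_self, insert_empty_eq]

theorem exists_isOpen_subset_forall_disjoint_or_subset_closure {ι : Type*} [Finite ι]
    (A : ι → Set X) {V : Set X} (hV : IsOpen V) (hne : V.Nonempty) :
    ∃ W ⊆ V, IsOpen W ∧ W.Nonempty ∧ ∀ i, Disjoint W (A i) ∨ W ⊆ closure (A i) := by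
  have := Fintype.ofFinite ι
  suffices h : ∀ s : Finset ι, ∃ W ⊆ V, IsOpen W ∧ W.Nonempty ∧
      ∀ i ∈ s, Disjoint W (A i) ∨ W ⊆ closure (A i) by
    simpa using h Finset.univ
  classical
  intro s
  induction s using Finset.induction_on with
  | empty => exact ⟨V, subset_rfl, hV, hne, by simp⟩
  | insert k s _ ih =>
    obtain ⟨W, hWV, hW, hWne, hWs⟩ := ih
    by_cases hk : W ⊆ closure (A k)
    · exact ⟨W, hWV, hW, hWne, Finset.forall_mem_insert _ _ _ |>.2 ⟨Or.inr hk, hWs⟩⟩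
    · refine ⟨W \ closure (A k), sdiff_subset.trans hWV, hW.sdiff isClosed_closure,
        sdiff_nonempty.2 hk, Finset.forall_mem_insert _ _ _ |>.2 ⟨Or.inl ?_, fun i hi => ?_⟩⟩
      · exact disjoint_sdiff_left.mono_right subset_closure
      · exact (hWs i hi).imp (·.mono_left sdiff_subset) sdiff_subset.trans

theorem dense_val_preimage {S A : Set X} (hS : Dense S) (hSA : S ⊆ A) :
    Dense (Subtype.val ⁻¹' S : Set A) := by
  rw [Subtype.dense_iff, Subtype.image_preimage_coe, inter_eq_right.2 hSA, hS.closure_eq]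
  exact subset_univ A

theorem isResolvable_of_dense [Nonempty X] {n : ℕ} {D : Fin n → Set X}
    (hdisj : Pairwise (Disjoint on D)) (hD : ∀ i, Dense (D i)) : IsResolvable n TX :=
  ⟨D, fun _ _ hij => hdisj hij, fun i => ⟨(hD i).nonempty, hD i⟩⟩

theorem IsResolvable.le_card_of_subset_iUnion {n : ℕ} (hres : IsResolvable n TX) {ι : Type*}
    [Finite ι] {D : ι → Set X} (hD : ∀ i, IsSubmaximalSet (D i)) {V : Set X} (hV : IsOpen V)
    (hne : V.Nonempty) (hVD : V ⊆ ⋃ i, D i) : n ≤ Nat.card ι := by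
  obtain ⟨E, hE, hEd⟩ := hres
  obtain ⟨W, hWV, hW, hWne, hWED⟩ := exists_isOpen_subset_forall_disjoint_or_subset_closure
    (fun p : Fin n × ι => E p.1 ∩ D p.2) hV hne
  have hpiece : ∀ j, ∃ i, W ⊆ closure (E j ∩ D i) := fun j => by
    obtain ⟨x, hxW, hxE⟩ := (hEd j).2.inter_open_nonempty W hW hWne
    obtain ⟨i, hxD⟩ := mem_iUnion.1 (hVD (hWV hxW))
    exact ⟨i, (hWED (j, i)).resolve_left (not_disjoint_iff.2 ⟨x, hxW, hxE, hxD⟩)⟩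
  choose piece hpiece using hpiece
  have hinj : Injective piece := fun j k hjk => by
    by_contra hne
    have hmeet : (E j ∩ E k).Nonempty := (hD (piece k)).inter_nonempty_of_subset_closure hW hWne
      (hjk ▸ hpiece j) (hpiece k)
    exact not_disjoint_iff_nonempty_inter.2 hmeet (hE j k hne)
  simpa using Nat.card_le_card_of_injective piece hinj

theorem IsResolvable.not_isOpen_singleton {n : ℕ} (hres : IsResolvable n TX) (hn : 1 < n) (x : X) :
    ¬ IsOpen {x} := by
  intro hx
  obtain ⟨E, hE, hEd⟩ := hres
  have hmem : ∀ i, x ∈ E i := fun i => by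
    simpa using (hEd i).2.inter_open_nonempty {x} hx (singleton_nonempty x)
  exact disjoint_left.1 (hE ⟨0, by lia⟩ ⟨1, hn⟩ (by simp)) (hmem _) (hmem _)

/- An expansion `U` of the topology of `X` is treated as the continuous bijection
`id : (X, U) → X`, so that each of the two topologies lives on its own type. -/
theorem exists_isOpen_preimage_inter_subset [T1Space X] {f : Y → X} (hf : Continuous f)
    (hinj : Injective f) (hY : ∀ y : Y, ¬ IsOpen {y}) {S : Set X} (hS : IsSubmaximalSet S)
    {W : Set Y} (hW : IsOpen W) (hWS : W ⊆ closure (f ⁻¹' S)) {O : Set X} (hO : IsOpen O)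
    (hne : (f ⁻¹' O ∩ W).Nonempty) :
    ∃ O' ⊆ O, IsOpen O' ∧ (f ⁻¹' O' ∩ W).Nonempty ∧ f ⁻¹' (S ∩ O') ⊆ W := by
  set V := f ⁻¹' O ∩ W
  have hV : IsOpen V := (hO.preimage hf).inter hW
  -- Otherwise the points of `S` coming from `V` would be isolated from each other, hence in `Y`.
  have hinterior : (interior (Subtype.val ⁻¹' (f '' V) : Set S)).Nonempty := by
    by_contra! hempty
    obtain ⟨y, hyV⟩ := hne
    obtain ⟨z, hzV, hzS⟩ := mem_closure_iff.1 (hWS hyV.2) V hV hyV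
    obtain ⟨_, ⟨G, hG, rfl⟩, hGz⟩ := hS.exists_isOpen_inter_eq_singleton hempty
      (a := ⟨f z, hzS⟩) ⟨z, hzV, rfl⟩
    have hzG : f z ∈ G := (hGz.superset rfl).1
    have hVG : IsOpen (V ∩ f ⁻¹' G) := hV.inter (hG.preimage hf)
    have htrace : V ∩ f ⁻¹' G ∩ f ⁻¹' S ⊆ {z} := fun w hw => by
      have hwz : (⟨f w, hw.2⟩ : S) ∈ ({⟨f z, hzS⟩} : Set S) := hGz ▸ ⟨hw.1.2, w, hw.1.1, rfl⟩
      exact hinj (congrArg Subtype.val hwz)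
    have : T1Space Y := t1Space_of_injective_of_continuous hinj hf
    have hsub : V ∩ f ⁻¹' G ⊆ {z} := calc
      V ∩ f ⁻¹' G ⊆ V ∩ f ⁻¹' G ∩ closure (f ⁻¹' S) := fun w hw => ⟨hw, hWS hw.1.2⟩
      _ ⊆ closure (V ∩ f ⁻¹' G ∩ f ⁻¹' S) := hVG.inter_closure
      _ ⊆ {z} := closure_minimal htrace isClosed_singleton
    exact hY z (hsub.antisymm (singleton_subset_iff.2 ⟨hzV, hzG⟩) ▸ hVG)
  obtain ⟨⟨x, hxS⟩, hx⟩ := hinterior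
  obtain ⟨_, hsub, ⟨G, hG, rfl⟩, hxG⟩ := mem_interior.1 hx
  have hGV : f ⁻¹' (S ∩ G) ⊆ V := fun w hw => hinj.mem_set_image.1 (hsub (a := ⟨f w, hw.1⟩) hw.2)
  obtain ⟨y, hyV, rfl⟩ : x ∈ f '' V := hsub hxG
  exact ⟨O ∩ G, inter_subset_left, hO.inter hG, ⟨y, ⟨hyV.1, hxG⟩, hyV.2⟩,
    fun w hw => (hGV ⟨hw.1, hw.2.2⟩).2⟩

theorem exists_isOpen_forall_preimage_inter_subset [T1Space X] {f : Y → X} (hf : Continuous f)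
    (hinj : Injective f) (hY : ∀ y : Y, ¬ IsOpen {y}) {ι : Type*} [Finite ι] {D : ι → Set X}
    (hD : ∀ i, IsSubmaximalSet (D i)) {W : Set Y} (hW : IsOpen W) (hne : W.Nonempty)
    (hWD : ∀ i, W ⊆ closure (f ⁻¹' D i)) :
    ∃ O : Set X, IsOpen O ∧ (f ⁻¹' O ∩ W).Nonempty ∧ ∀ i, f ⁻¹' (D i ∩ O) ⊆ W := by
  have := Fintype.ofFinite ι
  suffices h : ∀ s : Finset ι, ∃ O : Set X, IsOpen O ∧ (f ⁻¹' O ∩ W).Nonempty ∧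
      ∀ i ∈ s, f ⁻¹' (D i ∩ O) ⊆ W by
    simpa using h Finset.univ
  classical
  intro s
  induction s using Finset.induction_on with
  | empty => exact ⟨univ, isOpen_univ, by simpa using hne, by simp⟩
  | insert k s _ ih =>
    obtain ⟨O, hO, hOne, hOs⟩ := ih
    obtain ⟨O', hO'O, hO', hO'ne, hO'k⟩ :=
      exists_isOpen_preimage_inter_subset hf hinj hY (hD k) hW (hWD k) hO hOne
    refine ⟨O', hO', hO'ne, Finset.forall_mem_insert _ _ _ |>.2 ⟨hO'k, fun i hi => ?_⟩⟩
    exact (preimage_mono (inter_subset_inter_right _ hO'O)).trans (hOs i hi)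

theorem dense_preimage_of_isQuasiRegular [T1Space X] {f : Y → X} (hf : Continuous f)
    (hbij : Bijective f) {n : ℕ} (hn : 1 < n) (hres : IsResolvable n TY)
    (hqr : IsQuasiRegular TY) {ι : Type*} [Finite ι] (hι : Nat.card ι < 2 * n) {D : ι → Set X}
    (hcov : ⋃ i, D i = univ) (hD : ∀ i, IsSubmaximalSet (D i)) (hDd : ∀ i, Dense (D i)) (j : ι) :
    Dense (f ⁻¹' D j) := by
  by_contra hj
  have hfD : ∀ i, IsSubmaximalSet (f ⁻¹' D i) := fun i => (hD i).preimage hf hbij.injective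
  have hmem : ∀ y, ∃ i, f y ∈ D i := fun y => mem_iUnion.1 (hcov ▸ mem_univ (f y))
  obtain ⟨V, hVj, hV, hVne, hVD⟩ := exists_isOpen_subset_forall_disjoint_or_subset_closure
    (fun i => f ⁻¹' D i) isClosed_closure.isOpen_compl
    (nonempty_compl.2 fun h => hj (dense_iff_closure_eq.2 h))
  let Meets (i : ι) : Prop := ¬ Disjoint V (f ⁻¹' D i)
  have hcard : n ≤ Nat.card {i // Meets i} :=
    hres.le_card_of_subset_iUnion (fun i : {i // Meets i} => hfD i) hV hVne fun y hy =>
      have ⟨i, hi⟩ := hmem y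
      mem_iUnion.2 ⟨⟨i, not_disjoint_iff.2 ⟨y, hy, hi⟩⟩, hi⟩
  obtain ⟨W, hW, hWne, hWV⟩ := hqr V hV hVne
  obtain ⟨O, hO, ⟨x, hxO, -⟩, hOW⟩ := exists_isOpen_forall_preimage_inter_subset hf
    hbij.injective (hres.not_isOpen_singleton hn) (fun i : {i // Meets i} => hD i) hW hWne
    fun i => (subset_closure.trans hWV).trans ((hVD i).resolve_left i.2)
  have hHne : (f ⁻¹' O \ closure W).Nonempty := by
    obtain ⟨z, hzO, hzj⟩ := (hDd j).inter_open_nonempty O hO ⟨f x, hxO⟩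
    obtain ⟨y, rfl⟩ := hbij.surjective z
    exact ⟨y, hzO, fun hy => hVj (hWV hy) (subset_closure hzj)⟩
  have hcard' : n ≤ Nat.card {i // ¬ Meets i} :=
    hres.le_card_of_subset_iUnion (fun i : {i // ¬ Meets i} => hfD i)
      ((hO.preimage hf).sdiff isClosed_closure) hHne fun y hy =>
      have ⟨i, hi⟩ := hmem y
      mem_iUnion.2 ⟨⟨i, fun hiV => hy.2 (subset_closure (hOW ⟨i, hiV⟩ ⟨hi, hy.1⟩))⟩, hi⟩
  classical
  have hsum : Nat.card {i // Meets i} + Nat.card {i // ¬ Meets i} = Nat.card ι := by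
    rw [← Nat.card_sum, Nat.card_congr (Equiv.sumCompl Meets)]
  lia

theorem isResolvable_of_isExpansion [T1Space X] {n m : ℕ} (hn : 1 < n) (hm : m < 2 * n)
    {D : Fin m → Set X} (hcov : ⋃ i, D i = univ) (hdisj : Pairwise (Disjoint on D))
    (hD : ∀ i, IsSubmaximalSet (D i)) (hDd : ∀ i, Dense (D i)) (U : TopologicalSpace X)
    (hU : IsExpansion U TX) (hres : IsResolvable n U) (hqr : IsQuasiRegular U) :
    IsResolvable m U := by
  have : Nonempty X := let ⟨_, _, hE⟩ := hres; (hE ⟨0, by lia⟩).1.to_type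
  exact @isResolvable_of_dense X U _ _ D hdisj fun i =>
    @dense_preimage_of_isQuasiRegular X X TX U _ id (continuous_id_iff_le.2 hU) bijective_id n hn
      hres hqr _ _ (by simpa) D hcov hD hDd i

end Submaximal

section Construction

theorem exists_maximal_filter {Y : Type*} {p : Set Y → Prop} (hp : Monotone p) {F₀ : Filter Y}
    (h₀ : ∀ I ∈ F₀, p I) :
    ∃ F ≤ F₀, (∀ I ∈ F, p I) ∧ ∀ A, (∀ I ∈ F, p (I ∩ A)) → A ∈ F := by
  obtain ⟨F, hF₀, hF⟩ := zorn_le_nonempty₀ {F : (Filter Y)ᵒᵈ | ∀ I ∈ F.ofDual, p I}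
    (fun c hc hchain G hG => by
      refine ⟨OrderDual.toDual (sInf (OrderDual.toDual ⁻¹' c)), fun I hI => ?_,
        fun G hG => sInf_le (α := Filter Y) hG⟩
      have hdir : DirectedOn (· ≥ ·) (OrderDual.toDual ⁻¹' c) := hchain.directedOn
      rw [OrderDual.ofDual_toDual, sInf_eq_iInf] at hI
      obtain ⟨G, hGc, hIG⟩ := (mem_biInf_of_directed (f := id) hdir ⟨G.ofDual, hG⟩).1 hI
      exact hc hGc I hIG)
    (OrderDual.toDual F₀) h₀
  refine ⟨F.ofDual, hF₀, hF.prop, fun A hA => ?_⟩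
  have hinf : ∀ I ∈ F.ofDual ⊓ 𝓟 A, p I := fun I hI =>
    hp (fun y hy => hy.1 hy.2) (hA _ (mem_inf_principal.1 hI))
  have hle : F.ofDual ≤ F.ofDual ⊓ 𝓟 A :=
    hF.le_of_ge (y := OrderDual.toDual (F.ofDual ⊓ 𝓟 A)) hinf (inf_le_left (α := Filter Y))
  exact le_principal_iff.1 (hle.trans inf_le_right)

theorem dense_image_inter_of_forall_eventually_eq {Y Ξ : Type*} {Z : Ξ → Type*}
    [∀ ξ, TopologicalSpace (Z ξ)] {F : Filter Y} {φ ψ : Y → ∀ ξ, Z ξ}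
    (hφψ : ∀ ξ, ∀ᶠ y in F, φ y ξ = ψ y ξ) {A : Set Y} (hA : ∀ I ∈ F, Dense (φ '' (I ∩ A)))
    {I : Set Y} (hI : I ∈ F) : Dense (ψ '' (I ∩ A)) := by
  refine dense_iff_inter_open.2 fun O hO ⟨x, hx⟩ => ?_
  obtain ⟨s, u, hu, hsub⟩ := isOpen_pi_iff.1 hO x hx
  have hagree : ∀ᶠ y in F, ∀ ξ ∈ s, φ y ξ = ψ y ξ :=
    (eventually_all_finset s).2 fun ξ _ => hφψ ξ
  obtain ⟨_, hyu, y, ⟨⟨hyI, hy⟩, hyA⟩, rfl⟩ := (hA _ (inter_mem hI hagree)).inter_open_nonempty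
    ((s : Set Ξ).pi u) (isOpen_set_pi s.finite_toSet fun ξ hξ => (hu ξ hξ).1)
    ⟨x, fun ξ hξ => (hu ξ hξ).2⟩
  exact ⟨ψ y, hsub fun ξ hξ => hy ξ hξ ▸ hyu ξ hξ, y, ⟨hyI, hyA⟩, rfl⟩

theorem isSubmaximalSet_range {Y Z : Type*} [TopologicalSpace Z] {F : Filter Y} {ψ : Y → Z}
    (hdense : ∀ I ∈ F, Dense (ψ '' I))
    (hmax : ∀ A, (∀ I ∈ F, Dense (ψ '' (I ∩ A))) → A ∈ F)
    (hopen : ∀ I ∈ F, ∃ O, IsOpen O ∧ ψ ⁻¹' O = I) : IsSubmaximalSet (range ψ) := by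
  intro S hS
  have hrange : DenseRange ψ := by simpa [DenseRange] using hdense univ univ_mem
  have hSd : Dense (Subtype.val '' S) :=
    (Dense.denseRange_val hrange).dense_image continuous_subtype_val hS
  have hmem : rangeFactorization ψ ⁻¹' S ∈ F := hmax _ fun I hI => by
    obtain ⟨O, hO, rfl⟩ := hopen I hI
    have hOd : Dense O := (hdense _ hI).mono (image_preimage_subset ψ O)
    have himage : ψ '' (rangeFactorization ψ ⁻¹' S) = Subtype.val '' S := by
      rw [← image_preimage_eq S rangeFactorization_surjective, ← image_comp,
        preimage_image_preimage]
      rfl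
    rw [inter_comm, image_inter_preimage, himage]
    exact hSd.inter_of_isOpen_right hOd hO
  obtain ⟨O, hO, hOS⟩ := hopen _ hmem
  refine ⟨O, hO, rangeFactorization_surjective.preimage_injective hOS⟩

theorem exists_forall_eventually_eq_and_separates {Y Ξ : Type*} {F : Filter Y}
    (hF : F ≤ cofinite) (φ : Y → Ξ → Bool) {f : Ξ → F.sets × Y} (hf : Surjective f) :
    ∃ ψ : Y → Ξ → Bool, (∀ ξ, ∀ᶠ y in F, φ y ξ = ψ y ξ) ∧
      ∀ I ∈ F, ∀ p ∈ I, ∃ ξ, ψ p ξ = true ∧ ∀ y, ψ y ξ = true → y ∈ I := by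
  classical
  -- If `f ξ = (I, p)`, the modified coordinate `ξ` is true at `p` and false off `I`.
  refine ⟨fun y ξ => y = (f ξ).2 || (y ∈ (f ξ).1.1 && φ y ξ), fun ξ => ?_, fun I hI p hp => ?_⟩
  · filter_upwards [(f ξ).1.2, hF (finite_singleton (f ξ).2).compl_mem_cofinite] with y hyI hyp
    have hyp : y ≠ (f ξ).2 := hyp
    simp [hyI, hyp]
  · obtain ⟨ξ, hξ⟩ := hf (⟨I, hI⟩, p)
    refine ⟨ξ, by simp [hξ], fun y hy => ?_⟩
    simp only [hξ, Bool.or_eq_true, decide_eq_true_eq, Bool.and_eq_true] at hy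
    exact hy.elim (· ▸ hp) And.left

theorem exists_injective_denseRange_isSubmaximalSet {Y Ξ : Type*} {φ : Y → Ξ → Bool}
    (hφ : ∀ I ∈ cofinite, Dense (φ '' I)) (e : Set Y × Y ↪ Ξ) :
    ∃ ψ : Y → Ξ → Bool, Injective ψ ∧ DenseRange ψ ∧ IsSubmaximalSet (range ψ) := by
  obtain ⟨F, hFcof, hFdense, hFmax⟩ := exists_maximal_filter
    (p := fun I => Dense (φ '' I)) (fun _ _ h hd => hd.mono (image_mono h)) hφ
  have : Nonempty Y := (hFdense univ univ_mem).nonempty.of_image.to_type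
  have hf := invFun_surjective
    (((Embedding.subtype (· ∈ F.sets)).prodMap (.refl Y)).trans e).injective
  obtain ⟨ψ, hψ, hsep⟩ := exists_forall_eventually_eq_and_separates hFcof φ hf
  have hdense : ∀ I ∈ F, Dense (ψ '' I) := fun I hI => by
    simpa using dense_image_inter_of_forall_eventually_eq hψ (A := univ) (by simpa) hI
  refine ⟨ψ, fun p q hpq => ?_, by simpa [DenseRange] using hdense univ univ_mem,
    isSubmaximalSet_range hdense (fun A hA => ?_) fun I hI => ?_⟩
  · by_contra hne
    obtain ⟨ξ, hp, hξ⟩ := hsep {q}ᶜ (hFcof (finite_singleton q).compl_mem_cofinite) p hne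
    exact hξ q (hpq ▸ hp) rfl
  · exact hFmax A fun I hI => dense_image_inter_of_forall_eventually_eq
      (fun ξ => (hψ ξ).mono fun _ => Eq.symm) hA hI
  · choose ξ hξ hξI using hsep I hI
    have hopen (η : Ξ) : IsOpen {x : Ξ → Bool | x η = true} :=
      (isOpen_discrete {true}).preimage (f := fun x : Ξ → Bool => x η) (continuous_apply η)
    refine ⟨⋃ (p) (hp : p ∈ I), {x | x (ξ p hp) = true},
      isOpen_iUnion fun p => isOpen_iUnion fun hp => hopen _, ?_⟩
    ext y
    simp only [mem_preimage, mem_iUnion₂, mem_ofPred_eq]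
    exact ⟨fun ⟨p, hp, hy⟩ => hξI p hp y hy, fun hy => ⟨y, hy, hξ y hy⟩⟩

/-- The case of two-point factors of the Hewitt–Marczewski–Pondiczery theorem. -/
theorem exists_denseRange_of_injective {α Ξ : Type*} {e : Ξ → Set α} (he : Injective e) :
    ∃ φ : Finset α × Finset (Finset α) → Ξ → Bool, DenseRange φ := by
  classical
  refine ⟨fun y ξ => y.1.filter (· ∈ e ξ) ∈ y.2, dense_iff_inter_open.2 fun O hO ⟨x, hx⟩ => ?_⟩
  obtain ⟨s, u, hu, hsub⟩ := isOpen_pi_iff.1 hO x hx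
  have hsep : ∀ ξ η, ∀ᶠ t : Finset α in atTop,
      t.filter (· ∈ e ξ) = t.filter (· ∈ e η) → ξ = η := fun ξ η => by
    by_cases hne : ξ = η
    · exact Eventually.of_forall fun _ _ => hne
    obtain ⟨a, ha⟩ : ∃ a, ¬ (a ∈ e ξ ↔ a ∈ e η) := by
      by_contra! h
      exact hne (he (Set.ext h))
    filter_upwards [eventually_ge_atTop {a}] with t hat h
    have hat : a ∈ t := Finset.singleton_subset_iff.1 hat
    exact absurd (by simpa [hat] using Finset.ext_iff.1 h a) ha
  obtain ⟨t, ht⟩ := ((eventually_all_finset s).2 fun ξ _ =>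
    (eventually_all_finset s).2 fun η _ => hsep ξ η).exists
  refine ⟨_, hsub fun ξ hξ => ?_, (t, (s.filter (x ·)).image fun η => t.filter (· ∈ e η)), rfl⟩
  convert (hu ξ hξ).2
  rw [Bool.eq_iff_iff, decide_eq_true_iff]
  simp only [Finset.mem_image, Finset.mem_filter]
  exact ⟨fun ⟨η, ⟨hη, hxη⟩, h⟩ => ht η hη ξ hξ h ▸ hxη, fun hxξ => ⟨ξ, ⟨hξ, hxξ⟩, rfl⟩⟩

theorem exists_homeomorph_pairwise_disjoint_preimage {Ξ ι : Type*} (D : Set (Ξ → Bool))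
    {f : Ξ → (D × D) × ι} (hf : Surjective f) :
    ∃ e : ι → (Ξ → Bool) ≃ₜ (Ξ → Bool), Pairwise (Disjoint on fun i => e i ⁻¹' D) := by
  classical
  -- If `f ξ = ((a, b), i)`, then `e i x = a` and `e j x = b` are incompatible at `ξ` for `j ≠ i`.
  let e (i : ι) : (Ξ → Bool) ≃ₜ (Ξ → Bool) := .piCongrRight fun ξ =>
    if i = (f ξ).2 ∧ (f ξ).1.1.1 ξ = (f ξ).1.2.1 ξ then Equiv.boolNot.toHomeomorphOfDiscrete
    else .refl Bool
  refine ⟨e, fun i j hij => disjoint_left.2 fun x hi hj => ?_⟩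
  obtain ⟨ξ, hξ⟩ := hf ((⟨e i x, hi⟩, ⟨e j x, hj⟩), i)
  have happly : ∀ k, e k x ξ = if k = i ∧ e i x ξ = e j x ξ then !x ξ else x ξ := fun k => by
    change (if k = (f ξ).2 ∧ _ then _ else _ : Bool ≃ₜ Bool) (x ξ) = _
    rw [hξ]
    split_ifs <;> rfl
  have hjx : e j x ξ = x ξ := by rw [happly, if_neg fun h => hij h.1.symm]
  by_cases heq : e i x ξ = e j x ξ
  · have hix : e i x ξ = !x ξ := by rw [happly, if_pos ⟨rfl, heq⟩]
    exact Bool.not_ne_self (x ξ) (hix.symm.trans (heq.trans hjx))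
  · have hix : e i x ξ = x ξ := by rw [happly, if_neg fun h => heq h.2]
    exact heq (hix.trans hjx.symm)

theorem exists_dense_isSubmaximalSet (κ : Cardinal.{u}) (hκ : ℵ₀ ≤ κ) :
    ∃ D : Set (CantorCube κ), Dense D ∧ IsSubmaximalSet D ∧ #D = κ := by
  let α : Type u := κ.out
  have hα : #α = κ := Cardinal.mk_out κ
  have : Infinite α := Cardinal.infinite_iff.2 (hα ▸ hκ)
  let Y : Type u := (Finset α × Finset (Finset α)) × ℕ
  have hY : #Y = κ := by
    simp only [Y, Cardinal.mk_prod, Cardinal.lift_id, Cardinal.mk_finset_of_infinite, hα,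
      Cardinal.mk_nat, Cardinal.lift_aleph0, Cardinal.lift_uzero, Cardinal.mul_eq_self hκ,
      Cardinal.mul_aleph0_eq hκ]
  have hΞ : #(2 ^ κ : Cardinal.{u}).out = 2 ^ κ := Cardinal.mk_out _
  obtain ⟨e⟩ : Nonempty ((2 ^ κ : Cardinal.{u}).out ≃ Set α) := by
    rw [← Cardinal.eq, hΞ, Cardinal.mk_set, hα]
  obtain ⟨e'⟩ : Nonempty (Set Y × Y ≃ (2 ^ κ : Cardinal.{u}).out) := by
    rw [← Cardinal.eq, hΞ, Cardinal.mk_prod, Cardinal.lift_id, Cardinal.lift_id, Cardinal.mk_set,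
      hY, Cardinal.mul_eq_left (hκ.trans (Cardinal.cantor κ).le) (Cardinal.cantor κ).le
        (Cardinal.aleph0_pos.trans_le hκ).ne']
  obtain ⟨φ, hφ⟩ := exists_denseRange_of_injective e.injective
  have hφcof : ∀ I ∈ (cofinite : Filter Y), Dense ((φ ∘ Prod.fst) '' I) := fun I hI => by
    refine hφ.mono ?_
    rintro _ ⟨y, rfl⟩
    have hev : ∀ᶠ k in cofinite, (y, k) ∈ I := (Prod.mk_right_injective y).tendsto_cofinite hI
    obtain ⟨k, hk⟩ := hev.exists
    exact ⟨(y, k), hk, rfl⟩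
  obtain ⟨ψ, hinj, hdense, hsub⟩ :=
    exists_injective_denseRange_isSubmaximalSet hφcof e'.toEmbedding
  exact ⟨range ψ, hdense, hsub, (Cardinal.mk_range_eq ψ hinj).trans hY⟩

theorem exists_seq_disjoint_dense_isSubmaximalSet (κ : Cardinal.{u}) (hκ : ℵ₀ ≤ κ) :
    ∃ D : ℕ → Set (CantorCube κ), Pairwise (Disjoint on D) ∧
      ∀ i, Dense (D i) ∧ IsSubmaximalSet (D i) ∧ #(D i) = κ := by
  obtain ⟨D, hdense, hsub, hcard⟩ := exists_dense_isSubmaximalSet κ hκ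
  obtain ⟨f, hf⟩ : ∃ f : (2 ^ κ : Cardinal.{u}).out → (D × D) × ℕ, Surjective f := by
    have hle : #((D × D) × ℕ) ≤ #(2 ^ κ : Cardinal.{u}).out := by
      simp only [Cardinal.mk_prod, Cardinal.lift_id, hcard, Cardinal.mk_nat, Cardinal.lift_aleph0,
        Cardinal.lift_uzero, Cardinal.mul_eq_self hκ, Cardinal.mul_aleph0_eq hκ, Cardinal.mk_out]
      exact (Cardinal.cantor κ).le
    obtain ⟨i⟩ := hle
    have : Nonempty D := hdense.nonempty.to_subtype
    exact ⟨invFun i, invFun_surjective i.injective⟩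
  obtain ⟨e, he⟩ := exists_homeomorph_pairwise_disjoint_preimage D hf
  exact ⟨fun i => e i ⁻¹' D, he, fun i => ⟨hdense.preimage (e i).isOpenMap,
    hsub.preimage (e i).continuous (e i).injective,
    (Cardinal.mk_preimage_equiv (e i).toEquiv D).trans hcard⟩⟩

theorem mk_iUnion_eq {α ι : Type*} [Countable ι] [Nonempty ι] {κ : Cardinal} (hκ : ℵ₀ ≤ κ)
    {D : ι → Set α} (hD : ∀ i, #(D i) = κ) : #(⋃ i, D i) = κ := by
  obtain ⟨i⟩ := ‹Nonempty ι›
  refine le_antisymm ?_ ((hD i).ge.trans (Cardinal.mk_le_mk_of_subset (subset_iUnion D i)))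
  have hle := Cardinal.mk_iUnion_le_sum_mk_lift (f := D)
  have hι : #ι ≤ ℵ₀ := Cardinal.mk_le_aleph0
  rw [funext hD, Cardinal.sum_const, Cardinal.mul_eq_right (Cardinal.aleph0_le_lift.2 hκ)
    ((Cardinal.lift_le_aleph0.2 hι).trans (Cardinal.aleph0_le_lift.2 hκ)) (by simp)] at hle
  exact Cardinal.lift_le.1 hle

end Construction

end Resolvability

theorem theorem3p7 (n : ℕ) (hn : 1 < n) (κ : Cardinal.{u}) (hκ : Cardinal.aleph0 ≤ κ) :
    ∃ X : Set (Resolvability.CantorCube κ),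
      Cardinal.mk X = κ ∧
      T35Space X ∧
      Resolvability.IsResolvable n (instTopologicalSpaceSubtype : TopologicalSpace X) ∧
      (¬ ∃ U : TopologicalSpace X,
        Resolvability.IsExpansion U (instTopologicalSpaceSubtype : TopologicalSpace X) ∧
        Resolvability.IsExactlyResolvable n U ∧ Resolvability.IsQuasiRegular U) ∧
      ∃ D : Fin (n + 1) → Set (Resolvability.CantorCube κ),
        X = ⋃ i, D i ∧
        (∀ i j, i ≠ j → Disjoint (D i) (D j)) ∧
        ∀ i, Dense (D i) ∧
          Resolvability.IsSubmaximal (instTopologicalSpaceSubtype : TopologicalSpace (D i)) := by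
  obtain ⟨D, hdisj, hD⟩ := Resolvability.exists_seq_disjoint_dense_isSubmaximalSet κ hκ
  let X : Set (Resolvability.CantorCube κ) := ⋃ i : Fin (n + 1), D i
  let E (i : Fin (n + 1)) : Set X := Subtype.val ⁻¹' D i
  have hE : Pairwise (Function.onFun Disjoint E) := fun i j hij =>
    (hdisj (Fin.val_injective.ne hij)).preimage _
  have hEd : ∀ i, Dense (E i) := fun i =>
    Resolvability.dense_val_preimage (hD i).1 (Set.subset_iUnion (fun i : Fin (n + 1) => D i) i)
  have hcov : ⋃ i, E i = Set.univ := Set.preimage_iUnion.symm.trans (Subtype.coe_preimage_self X)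
  have hX : Cardinal.mk X = κ := Resolvability.mk_iUnion_eq hκ fun i => (hD i).2.2
  have : Nonempty X := Cardinal.mk_ne_zero_iff.1 (hX.trans_ne (Cardinal.aleph0_pos.trans_le hκ).ne')
  refine ⟨X, hX, inferInstance, ?_, ?_, fun i => D i, rfl,
    fun i j hij => hdisj (Fin.val_injective.ne hij), fun i => ⟨(hD i).1, (hD i).2.1⟩⟩
  · exact Resolvability.isResolvable_of_dense (hE.comp_of_injective (Fin.castSucc_injective n))
      fun i => hEd i.castSucc
  · have hexp := Resolvability.isResolvable_of_isExpansion hn (by lia) hcov hE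
      (fun i => (hD i).2.1.preimage continuous_subtype_val Subtype.val_injective) hEd
    exact fun ⟨U, hU, ⟨hres, hnres⟩, hqr⟩ => hnres (hexp U hU hres hqr)
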